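/- All spaces are Tychonov (completely regular and Hausdorff) and all maps are continuous; $C(X)$ is the set of continuous real-valued functions on $X$, and $\dim$ is Lebesgue covering dimension, so $\dim Z\le n$ means that every finite functionally open cover of $Z$ has a finite functionally open refinement of which each point lies in at most $n+1$ members. A space $X$ is an $AE(0)$-space if for every space $Z$ with $\dim Z\le 0$ and every subspace $Z_0\subseteq Z$, each map $f\colon Z_0\to X$ such that $\varphi\circ f$ extends to an element of $C(Z)$ for every $\varphi\in C(X)$ can itself be extended to a map $Z\to X$. A map $f\colon X\to Y$ between $AE(0)$-spaces is $0$-soft if for every realcompact space $Z$ with $\dim Z\le 0$, every closed $Z_0\subseteq Z$ and all maps $g\colon Z_0\to X$, $h\colon Z\to Y$ such that $f\circ g=h|Z_0$ and $\varphi\circ g$ extends to an element of $C(Z)$ for every $\varphi\in C(X)$, there is a map $k\colon Z\to X$ with $k|Z_0=g$ and $f\circ k=h$. An $AE(0)$-group is a topological group whose underlying space is an $AE(0)$-space. An inverse spectrum $\mathcal S=\{X_\alpha,p_\alpha^\beta,A\}$ is an $\omega$-spectrum if $A$ is a non-empty directed partially ordered set in which every countable chain has a supremum, every $X_\alpha$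 has countable weight, and, for every non-empty countable chain $B\subseteq A$ with $\beta=\sup B$, the diagonal product $\triangle\{p_\alpha^\beta\colon\alpha\in B\}\colon X_\beta\to\lim(\mathcal S|B)$ is a homeomorphism. It is factorizing if for every $\varphi\in C(\lim\mathcal S)$ there are $\alpha\in A$ and $\psi\in C(X_\alpha)$ such that $\varphi=\psi\circ p_\alpha$, where $p_\alpha\colon\lim\mathcal S\to X_\alpha$ is the limit projection. **Proposition 3.1.** Each topological $AE(0)$-group $G$ is topologically and algebraically isomorphic to the limit of a factorizing $\omega$-spectrum $\mathcal S_G=\{G_\alpha,p_\alpha^\beta,A\}$ consisting of Polish groups $G_\alpha$, $\alpha\in A$, and continuous homomorphisms $p_\alpha^\beta\colon G_\beta\to G_\alpha$, $\alpha\le\beta$, whose limit projections $p_\alpha\colon G\to G_\alpha$, $\alpha\in A$, are $0$-soft homomorphisms. In particular, all short projections $p_\alpha^\beta\colon G_\beta\to G_\alpha$, $\alpha\le\beta$, are $0$-soft homomorphisms. -/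

import Mathlib

universe u

/-- A functionally open (cozero) set: the set where some continuous real-valued function
does not vanish. -/
def IsFunctionallyOpen {Z : Type u} [TopologicalSpace Z] (U : Set Z) : Prop :=
  ∃ φ : C(Z, ℝ), U = {z | φ z ≠ 0}

/-- `dim Z ≤ n` for the Lebesgue (covering) dimension of Tychonov spaces: every finite
functionally open cover has a finite functionally open refinement (covering `Z`) such that each
point belongs to at most `n + 1` of its members. -/
def LebesgueDimLE (n : ℕ) (Z : Type u) [TopologicalSpace Z] : Prop :=
  ∀ 𝒰 : Set (Set Z), 𝒰.Finite → (∀ U ∈ 𝒰, IsFunctionallyOpen U) → ⋃₀ 𝒰 = Set.univ →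
    ∃ 𝒱 : Set (Set Z), 𝒱.Finite ∧ (∀ V ∈ 𝒱, IsFunctionallyOpen V) ∧ ⋃₀ 𝒱 = Set.univ ∧
      (∀ V ∈ 𝒱, ∃ U ∈ 𝒰, V ⊆ U) ∧ ∀ z : Z, {V | V ∈ 𝒱 ∧ z ∈ V}.ncard ≤ n + 1

/-- A realcompact space: one that is homeomorphic to a closed subspace of a power of the
real line. -/
def IsRealcompact (Z : Type u) [TopologicalSpace Z] : Prop :=
  ∃ (ι : Type u) (j : Z → (ι → ℝ)), Topology.IsClosedEmbedding j

/-- The inclusion `C(g)(C(X)) ⊆ {φ|Z₀ : φ ∈ C(Z)}` for a map `g : Z₀ → X`: the composition with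
`g` of every continuous real-valued function on `X` extends continuously to all of `Z`. -/
def PullbacksExtend {Z X : Type u} [TopologicalSpace Z] [TopologicalSpace X] {Z₀ : Set Z}
    (g : C(Z₀, X)) : Prop :=
  ∀ φ : C(X, ℝ), ∃ ψ : C(Z, ℝ), ∀ z : Z₀, ψ z = φ (g z)

/-- Absolute extensors in dimension `n`, i.e. `AE(n)`-spaces. -/
structure IsAE (n : ℕ) (X : Type u) [TopologicalSpace X] : Prop where
  tychonov : T35Space X
  exists_extension : ∀ (Z : Type u) [TopologicalSpace Z] [T35Space Z], LebesgueDimLE n Z →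
    ∀ (Z₀ : Set Z) (f : C(Z₀, X)), PullbacksExtend f →
      ∃ k : C(Z, X), ∀ z : Z₀, k z = f z

/-- `n`-soft maps between `AE(n)`-spaces. -/
structure IsSoft (n : ℕ) {X Y : Type u} [TopologicalSpace X] [TopologicalSpace Y]
    (f : X → Y) : Prop where
  continuous : Continuous f
  source : IsAE n X
  target : IsAE n Y
  exists_lift : ∀ (Z : Type u) [TopologicalSpace Z] [T35Space Z], LebesgueDimLE n Z →
    IsRealcompact Z → ∀ Z₀ : Set Z, IsClosed Z₀ → ∀ (g : C(Z₀, X)) (h : C(Z, Y)),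
      (∀ z : Z₀, f (g z) = h z) → PullbacksExtend g →
        ∃ k : C(Z, X), (∀ z : Z₀, k z = g z) ∧ ∀ z : Z, f (k z) = h z

/-- An inverse spectrum of topological spaces indexed by a partially ordered set. -/
structure InverseSpectrum (A : Type u) [PartialOrder A] where
  space : A → Type u
  [top : ∀ a, TopologicalSpace (space a)]
  map : ∀ {a b : A}, a ≤ b → C(space b, space a)
  map_self : ∀ (a : A) (x : space a), map (le_refl a) x = x
  map_map : ∀ {a b c : A} (hab : a ≤ b) (hbc : b ≤ c) (x : space c),
    map hab (map hbc x) = map (hab.trans hbc) x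

attribute [instance] InverseSpectrum.top

namespace InverseSpectrum

variable {A : Type u} [PartialOrder A] (S : InverseSpectrum A)

/-- The limit of the restriction of the spectrum to a set `B` of indices: the set of threads, with
the topology inherited from the product. -/
def limitOn (B : Set A) : Set (∀ b : B, S.space b) :=
  {x | ∀ (b c : B) (h : (b : A) ≤ c), S.map h (x c) = x b}

/-- The diagonal product of the projections from the space at `a` to the spaces at the members
of `B`, where `a` is an upper bound of `B`. -/
def diagonal (B : Set A) (a : A) (ha : a ∈ upperBounds B) (x : S.space a) : S.limitOn B :=
  ⟨fun b => S.map (ha b.2) x, fun _ c h => S.map_map h (ha c.2) x⟩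

/-- The limit of the spectrum. -/
def limit : Set (∀ a : A, S.space a) :=
  {x | ∀ (a b : A) (h : a ≤ b), S.map h (x b) = x a}

/-- Every continuous real-valued function on the limit factors through a limit projection. -/
def IsFactorizing : Prop :=
  ∀ φ : C(S.limit, ℝ), ∃ (a : A) (ψ : C(S.space a, ℝ)), ∀ x : S.limit, φ x = ψ (x.1 a)

/-- An `ω`-spectrum: the index set is directed and `ω`-complete, the spaces are Tychonov of
countable weight, and the spectrum is `ω`-continuous. -/
structure IsOmegaSpectrum : Prop where
  nonempty : Nonempty A
  directed : ∀ a b : A, ∃ c : A, a ≤ c ∧ b ≤ c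
  complete : ∀ C : Set A, IsChain (· ≤ ·) C → C.Countable → ∃ s : A, IsLUB C s
  tychonov : ∀ a, T35Space (S.space a)
  countable_weight : ∀ a, SecondCountableTopology (S.space a)
  continuous : ∀ C : Set A, C.Nonempty → IsChain (· ≤ ·) C → C.Countable →
    ∀ (s : A) (hs : IsLUB C s), IsHomeomorph (S.diagonal C s hs.1)

end InverseSpectrum

/-- An inverse spectrum of topological groups and continuous homomorphisms. -/
structure GroupSpectrum (A : Type u) [PartialOrder A] where
  group : A → Type u
  [grp : ∀ a, Group (group a)]
  [top : ∀ a, TopologicalSpace (group a)]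
  [topGroup : ∀ a, IsTopologicalGroup (group a)]
  map : ∀ {a b : A}, a ≤ b → (group b →ₜ* group a)
  map_self : ∀ (a : A) (x : group a), map (le_refl a) x = x
  map_map : ∀ {a b c : A} (hab : a ≤ b) (hbc : b ≤ c) (x : group c),
    map hab (map hbc x) = map (hab.trans hbc) x

attribute [instance] GroupSpectrum.grp GroupSpectrum.top GroupSpectrum.topGroup

namespace GroupSpectrum

variable {A : Type u} [PartialOrder A] (S : GroupSpectrum A)

/-- The underlying spectrum of topological spaces. -/
def toInverseSpectrum : InverseSpectrum A where
  space := S.group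
  top := S.top
  map h := ⟨S.map h, (S.map h).continuous_toFun⟩
  map_self := S.map_self
  map_map := S.map_map

/-- The limit of a spectrum of topological groups: the limit of the underlying spectrum of spaces,
as a topological subgroup of the product. -/
def limit : Subgroup (∀ a : A, S.group a) where
  carrier := S.toInverseSpectrum.limit
  one_mem' := fun _ _ h => map_one (S.map h)
  mul_mem' := by
    intro x y hx hy a b h
    exact (map_mul (S.map h) (x b) (y b)).trans (congrArg₂ (· * ·) (hx a b h) (hy a b h))
  inv_mem' := by
    intro x hx a b h
    exact (map_inv (S.map h) (x b)).trans (congrArg (·⁻¹) (hx a b h))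

/-- The limit projection to the group at `a`, as a homomorphism. -/
def limitProj (a : A) : S.limit →* S.group a :=
  (Pi.evalMonoidHom S.group a).comp S.limit.subtype

end GroupSpectrum

/-! Real coordinates are replaced by zero-dimensional ones. A `DyadicCode` is a real number together
with integer approximations to its multiples by 2^n. Codes have a clopen base, and real functions on
zero-dimensional spaces lift to codes through `val`. The power of `DyadicCode` indexed by C(G) is
zero-dimensional, because continuous real functions on it depend on countably many coordinates.
Hence the AE(0) property yields a continuous k from this power to G that sends every code of the
evaluations at x to x (`IsAE.exists_isDecoding`).

A set S of functions is closed if, for φ ∈ S, φ(k z * k w) depends only on the S-coordinates of z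
and w. Every countable set lies in a countable closed one, and unions of closed sets are closed.
Agreement on a closed S is a congruence on G, so S determines a normal subgroup. The quotient is a
closed subspace of ℝ^S, hence Polish when S is countable. These quotients, ordered by inclusion of
the sets S, form the spectrum.

Extension and lifting problems over a zero-dimensional Z are solved coordinatewise: find real
functions on Z with the required values, lift them to codes, apply k and project. Closedness makes
the coordinates outside S irrelevant. -/

open Filter Topology Set TopologicalSpace

/-! ### Continuous functions on powers depend on countably many coordinates -/

/-- A countable set can be enlarged to a countable set closed under a countable-valued operation
on finite subsets. -/
theorem exists_countable_superset_closed {ι : Type*} (F : Finset ι → Set ι)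
    (hF : ∀ T, (F T).Countable) {S₀ : Set ι} (hS₀ : S₀.Countable) :
    ∃ S, S₀ ⊆ S ∧ S.Countable ∧ ∀ T : Finset ι, (T : Set ι) ⊆ S → F T ⊆ S := by
  classical
  let step : Set ι → Set ι := fun S => S ∪ ⋃ T ∈ {T : Finset ι | (T : Set ι) ⊆ S}, F T
  let seq : ℕ → Set ι := fun n => step^[n] S₀
  have hseq : ∀ n, seq (n + 1) = step (seq n) := fun n => Function.iterate_succ_apply' step n S₀
  have hcount : ∀ n, (seq n).Countable := by
    intro n
    induction n with
    | zero => exact hS₀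
    | succ n ih =>
      rw [hseq]
      have hT : {T : Finset ι | (T : Set ι) ⊆ seq n}.Countable :=
        ((countable_ofPred_finite_subset ih).preimage Finset.coe_injective).mono
          fun T (hT : (T : Set ι) ⊆ seq n) => mem_preimage.2 (mem_ofPred.2 ⟨T.finite_toSet, hT⟩)
      exact ih.union (hT.biUnion fun T _ => hF T)
  have hmono : Monotone seq := monotone_nat_of_le_succ fun n => by
    rw [hseq]; exact subset_union_left
  refine ⟨⋃ n, seq n, subset_iUnion seq 0, countable_iUnion hcount, fun T hT => ?_⟩
  obtain ⟨n, hn⟩ :=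
    Directed.exists_mem_subset_of_finset_subset_biUnion hmono.directed_le hT
  refine Subset.trans ?_ (subset_iUnion seq (n + 1))
  rw [hseq]
  exact subset_union_of_subset_right (subset_biUnion_of_mem (u := F) hn) _

/-- The value of a continuous function at a point of a product is determined by countably many
coordinates of that point. -/
theorem exists_countable_forall_eq_of_continuousAt {ι X : Type*} [TopologicalSpace X]
    {f : (ι → X) → ℝ} {d : ι → X} (hf : ContinuousAt f d) :
    ∃ S : Set ι, S.Countable ∧ ∀ x, (∀ i ∈ S, x i = d i) → f x = f d := by
  have h : ∀ n : ℕ, ∃ I : Set ι, I.Finite ∧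
      ∀ x, (∀ i ∈ I, x i = d i) → dist (f x) (f d) < 1 / (n + 1 : ℝ) := by
    intro n
    have := hf (Metric.ball_mem_nhds (f d) (Nat.one_div_pos_of_nat (n := n)))
    rw [mem_map, nhds_pi, Filter.mem_pi] at this
    obtain ⟨I, hI, t, ht, hsub⟩ := this
    exact ⟨I, hI, fun x hx => hsub fun i hi => by rw [hx i hi]; exact mem_of_mem_nhds (ht i)⟩
  choose I hI hId using h
  refine ⟨⋃ n, I n, countable_iUnion fun n => (hI n).countable, fun x hx => ?_⟩
  refine eq_of_forall_dist_le fun ε hε => ?_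
  obtain ⟨n, hn⟩ := exists_nat_one_div_lt hε
  exact ((hId n x fun i hi => hx i (mem_iUnion_of_mem n hi)).trans hn).le

/-- A continuous real-valued function on a power of a separable space depends on countably many
coordinates. -/
theorem Continuous.exists_countable_dependsOn {ι X : Type*} [TopologicalSpace X]
    [SeparableSpace X] [Nonempty X] {f : (ι → X) → ℝ} (hf : Continuous f) :
    ∃ S : Set ι, S.Countable ∧ DependsOn f S := by
  classical
  obtain ⟨a⟩ := ‹Nonempty X›
  let ext : ∀ T : Finset ι, (T → X) → ι → X := fun T u i => if h : i ∈ T then u ⟨i, h⟩ else a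
  let D : ∀ T : Finset ι, ℕ → ι → X := fun T n => ext T (denseSeq (T → X) n)
  choose F hF hFd using fun d : ι → X =>
    exists_countable_forall_eq_of_continuousAt (hf.continuousAt (x := d))
  -- For finite `T ⊆ S`, the set `S` contains coordinates determining `f` at every `D T n`. So `f (D
  -- T n)` survives any change of coordinates off `S`, in particular to those of `x` or of `y`.
  obtain ⟨S, -, hS, hcl⟩ := exists_countable_superset_closed (fun T => ⋃ n, F (D T n))
    (fun T => countable_iUnion fun n => hF _) countable_empty
  refine ⟨S, hS, fun x y hxy => eq_of_forall_dist_le fun ε hε => ?_⟩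
  have box : ∀ x, ∃ I : Set ι, I.Finite ∧ ∃ t : ι → Set X, (∀ i, t i ∈ 𝓝 (x i)) ∧
      ∀ w ∈ I.pi t, dist (f w) (f x) < ε / 2 := by
    intro x
    have := hf.continuousAt (x := x) (Metric.ball_mem_nhds (f x) (half_pos hε))
    rw [mem_map, nhds_pi, Filter.mem_pi] at this
    obtain ⟨I, hI, t, ht, hsub⟩ := this
    exact ⟨I, hI, t, ht, fun w hw => hsub hw⟩
  obtain ⟨I, hI, t, ht, hbx⟩ := box x
  obtain ⟨J, hJ, t', ht', hby⟩ := box y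
  let T : Finset ι := ((hI.union hJ).inter_of_left S).toFinset
  have hTS : (T : Set ι) ⊆ S := by
    intro i hi
    simp only [T, Finite.coe_toFinset] at hi
    exact hi.2
  have hmem : (univ : Set T).pi (fun i => t i ∩ t' i) ∈ 𝓝 (fun i : T => x i) :=
    set_pi_mem_nhds finite_univ fun i _ =>
      inter_mem (ht i) (by rw [hxy i (hTS i.2)]; exact ht' i)
  obtain ⟨_, ⟨n, rfl⟩, hn⟩ :=
    (mem_closure_iff_nhds'.1 ((denseRange_denseSeq (T → X)) (fun i : T => x i)) _ hmem) |>
      fun ⟨v, hv⟩ => (⟨v, v.2, hv⟩ : ∃ v, v ∈ range (denseSeq (T → X)) ∧ v ∈ _)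
  have hD : ∀ i ∈ T, D T n i ∈ t i ∩ t' i := by
    intro i hi
    simpa only [D, ext, dif_pos hi] using hn ⟨i, hi⟩ (mem_univ _)
  have hd : ∀ w : ι → X, f (S.piecewise (D T n) w) = f (D T n) := fun w =>
    hFd _ _ fun i hi => piecewise_eq_of_mem _ _ _ (hcl T hTS (mem_iUnion_of_mem n hi))
  have h1 : dist (f (D T n)) (f x) < ε / 2 := by
    rw [← hd x]
    refine hbx _ fun i hi => ?_
    by_cases his : i ∈ S
    · rw [piecewise_eq_of_mem _ _ _ his]
      exact (hD i (by simp [T, hi, his])).1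
    · rw [piecewise_eq_of_notMem _ _ _ his]
      exact mem_of_mem_nhds (ht i)
  have h2 : dist (f (D T n)) (f y) < ε / 2 := by
    rw [← hd y]
    refine hby _ fun i hi => ?_
    by_cases his : i ∈ S
    · rw [piecewise_eq_of_mem _ _ _ his]
      exact (hD i (by simp [T, hi, his])).2
    · rw [piecewise_eq_of_notMem _ _ _ his]
      exact mem_of_mem_nhds (ht' i)
  linarith [dist_triangle_left (f x) (f y) (f (D T n))]

/-! ### Criteria for zero-dimensionality -/

theorem isFunctionallyOpen_of_isClopen {Z : Type u} [TopologicalSpace Z] {U : Set Z}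
    (hU : IsClopen U) : IsFunctionallyOpen U := by
  classical
  refine ⟨⟨U.indicator 1, (IsLocallyConstant.const 1).continuous.indicator (by simp [hU.frontier_eq])⟩, ?_⟩
  ext z
  simp

/-- Lindelöf spaces whose points have arbitrarily small clopen neighbourhoods are
zero-dimensional. -/
theorem lebesgueDimLE_zero_of_isClopen_nhds {Z : Type u} [TopologicalSpace Z]
    [SecondCountableTopology Z]
    (h : ∀ (z : Z) (U : Set Z), IsOpen U → z ∈ U → ∃ V, IsClopen V ∧ z ∈ V ∧ V ⊆ U) :
    LebesgueDimLE 0 Z := by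
  classical
  intro 𝒰 hfin hopen hcov
  have hz : ∀ z : Z, ∃ U ∈ 𝒰, ∃ V, IsClopen V ∧ z ∈ V ∧ V ⊆ U := by
    intro z
    obtain ⟨U, hU, hzU⟩ := mem_sUnion.1 (hcov.symm ▸ mem_univ z)
    obtain ⟨φ, rfl⟩ := hopen U hU
    exact ⟨_, hU, h z _ (isOpen_ne_fun φ.continuous continuous_const) hzU⟩
  choose U hU V hV hzV hVU using hz
  obtain ⟨s, hs, hscov⟩ := TopologicalSpace.countable_cover_nhds fun z => (hV z).isOpen.mem_nhds (hzV z)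
  rcases isEmpty_or_nonempty Z with hZ | hZ
  · exact ⟨∅, finite_empty, by simp, Subsingleton.elim _ _, by simp, fun z => (hZ.false z).elim⟩
  have hsne : s.Nonempty := by
    obtain ⟨z⟩ := hZ
    obtain ⟨w, hw, -⟩ := mem_iUnion₂.1 (hscov.symm ▸ mem_univ z)
    exact ⟨w, hw⟩
  obtain ⟨e, rfl⟩ := hs.exists_eq_range hsne
  let D : ℕ → Set Z := disjointed fun n => V (e n)
  have hDclopen : ∀ n, IsClopen (D n) := fun n =>
    disjointedRec (fun t i ht => ht.diff (hV _)) (hV (e n))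
  have hDdisj : Pairwise (Function.onFun Disjoint D) := disjoint_disjointed _
  have hDcov : ⋃ n, D n = univ := by
    rw [iUnion_disjointed, ← hscov, biUnion_range]
  -- Grouping the disjoint clopen pieces by the chosen member of `𝒰` makes the refinement finite.
  let W : Set Z → Set Z := fun A => ⋃ n ∈ {n | U (e n) = A}, D n
  have hWmem : ∀ n z, z ∈ D n → ∀ A, z ∈ W A → A = U (e n) := by
    intro n z hz A hA
    obtain ⟨m, hm, hzm⟩ := mem_iUnion₂.1 hA
    have : m = n := by
      by_contra hne
      exact disjoint_left.1 (hDdisj hne) hzm hz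
    rw [← this]; exact hm.symm
  have hWopen : ∀ A, IsOpen (W A) := fun A => isOpen_biUnion fun n _ => (hDclopen n).isOpen
  have hWclopen : ∀ A, IsClopen (W A) := by
    intro A
    refine ⟨⟨?_⟩, hWopen A⟩
    have : (W A)ᶜ = ⋃ n ∈ {n | U (e n) ≠ A}, D n := by
      ext z
      obtain ⟨n, hn⟩ := mem_iUnion.1 (hDcov.symm ▸ mem_univ z)
      constructor
      · intro hz
        refine mem_iUnion₂.2 ⟨n, fun hA => hz (mem_iUnion₂.2 ⟨n, hA, hn⟩), hn⟩
      · intro hz hA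
        obtain ⟨m, hm, hzm⟩ := mem_iUnion₂.1 hz
        exact hm (hWmem m z hzm A hA).symm
    rw [this]
    exact isOpen_biUnion fun n _ => (hDclopen n).isOpen
  refine ⟨W '' 𝒰, hfin.image W, ?_, ?_, ?_, ?_⟩
  · rintro _ ⟨A, -, rfl⟩
    exact isFunctionallyOpen_of_isClopen (hWclopen A)
  · refine eq_univ_of_forall fun z => ?_
    obtain ⟨n, hn⟩ := mem_iUnion.1 (hDcov.symm ▸ mem_univ z)
    exact ⟨_, ⟨U (e n), hU _, rfl⟩, mem_iUnion₂.2 ⟨n, rfl, hn⟩⟩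
  · rintro _ ⟨A, hA, rfl⟩
    refine ⟨A, hA, iUnion₂_subset fun n hn => ?_⟩
    exact (disjointed_subset _ n).trans ((hVU (e n)).trans hn.subset)
  · intro z
    obtain ⟨n, hn⟩ := mem_iUnion.1 (hDcov.symm ▸ mem_univ z)
    refine (ncard_le_ncard (t := {W (U (e n))}) ?_ (finite_singleton _)).trans (by simp)
    rintro _ ⟨⟨A, -, rfl⟩, hz⟩
    rw [hWmem n z hn A hz]; rfl

/-- A power of a separable space is zero-dimensional if its countable subpowers are. -/
theorem lebesgueDimLE_zero_pi {ι : Type u} {X : Type} [TopologicalSpace X] [SeparableSpace X]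
    [Nonempty X] (h : ∀ S : Set ι, S.Countable → LebesgueDimLE 0 (S → X)) :
    LebesgueDimLE 0 (ι → X) := by
  classical
  intro 𝒰 hfin hopen hcov
  choose! φ hφ using hopen
  choose S hS hdep using fun U => (φ U).continuous.exists_countable_dependsOn
  let T : Set ι := ⋃ U ∈ 𝒰, S U
  have hT : T.Countable := hfin.countable.biUnion fun U _ => hS U
  obtain ⟨a⟩ := ‹Nonempty X›
  let r : (ι → X) → T → X := fun x i => x i
  have hr : Continuous r := by fun_prop
  let e : (T → X) → ι → X := fun u i => if hi : i ∈ T then u ⟨i, hi⟩ else a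
  have he : Continuous e := by
    refine continuous_pi fun i => ?_
    by_cases hi : i ∈ T
    · simpa only [e, dif_pos hi] using continuous_apply _
    · simpa only [e, dif_neg hi] using continuous_const
  have hφe : ∀ U ∈ 𝒰, ∀ x, φ U (e (r x)) = φ U x := fun U hU x => hdep U fun i hi => by
    have : i ∈ T := mem_biUnion hU hi
    simp [e, r, this]
  have hpre : ∀ U ∈ 𝒰, r ⁻¹' (e ⁻¹' U) = U := by
    intro U hU
    ext x
    rw [hφ U hU]
    simp [hφe U hU]
  obtain ⟨𝒱, h𝒱fin, h𝒱open, h𝒱cov, h𝒱ref, h𝒱ord⟩ :=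
    h T hT ((fun U => e ⁻¹' U) '' 𝒰) (hfin.image _)
      (by
        rintro _ ⟨U, hU, rfl⟩
        refine ⟨(φ U).comp ⟨e, he⟩, ?_⟩
        show e ⁻¹' U = _
        conv_lhs => rw [hφ U hU]
        rfl)
      (by
        refine eq_univ_of_forall fun u => ?_
        obtain ⟨U, hU, hu⟩ := mem_sUnion.1 (hcov.symm ▸ mem_univ (e u))
        exact ⟨_, ⟨U, hU, rfl⟩, hu⟩)
  refine ⟨(fun V => r ⁻¹' V) '' 𝒱, h𝒱fin.image _, ?_, ?_, ?_, ?_⟩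
  · rintro _ ⟨V, hV, rfl⟩
    obtain ⟨ψ, rfl⟩ := h𝒱open V hV
    exact ⟨ψ.comp ⟨r, hr⟩, rfl⟩
  · refine eq_univ_of_forall fun x => ?_
    obtain ⟨V, hV, hx⟩ := mem_sUnion.1 (h𝒱cov.symm ▸ mem_univ (r x))
    exact ⟨_, ⟨V, hV, rfl⟩, hx⟩
  · rintro _ ⟨V, hV, rfl⟩
    obtain ⟨_, ⟨U, hU, rfl⟩, hVU⟩ := h𝒱ref V hV
    exact ⟨U, hU, (preimage_mono hVU).trans (hpre U hU).subset⟩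
  · intro x
    refine le_trans (ncard_le_ncard (t := (fun V => r ⁻¹' V) '' {V | V ∈ 𝒱 ∧ r x ∈ V}) ?_
      ((h𝒱fin.subset fun V hV => hV.1).image _))
      ((ncard_image_le (h𝒱fin.subset fun V hV => hV.1)).trans (h𝒱ord (r x)))
    rintro _ ⟨⟨V, hV, rfl⟩, hx⟩
    exact ⟨V, ⟨hV, hx⟩, rfl⟩

/-! ### Real and integer-valued functions on zero-dimensional spaces -/

theorem continuous_iff_forall_comp {Z X : Type*} [TopologicalSpace Z] [TopologicalSpace X]
    [CompletelyRegularSpace X] {f : Z → X} :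
    Continuous f ↔ ∀ φ : C(X, ℝ), Continuous fun z => φ (f z) := by
  refine ⟨fun h φ => φ.continuous.comp h, fun h => continuous_iff_continuousAt.2 fun z => ?_⟩
  refine tendsto_nhds.2 fun U hU hz => ?_
  obtain ⟨g, hg, hg0, hg1⟩ :=
    CompletelyRegularSpace.completely_regular (f z) Uᶜ hU.isClosed_compl (by simpa using hz)
  have hφ := h ⟨fun x => (g x : ℝ), continuous_subtype_val.comp hg⟩
  have : ∀ᶠ w in 𝓝 z, ((g (f w) : unitInterval) : ℝ) < 1 :=
    hφ.continuousAt.eventually (gt_mem_nhds (by simp [hg0]))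
  filter_upwards [this] with w hw
  by_contra hwU
  have := hg1 hwU
  simp [this] at hw

/-- In a zero-dimensional space, a cover by two functionally open sets is refined by a clopen set
and its complement. -/
theorem LebesgueDimLE.exists_isClopen {Z : Type u} [TopologicalSpace Z] (hZ : LebesgueDimLE 0 Z)
    (φ ψ : C(Z, ℝ)) (h : ∀ z, φ z ≠ 0 ∨ ψ z ≠ 0) :
    ∃ W : Set Z, IsClopen W ∧ (∀ z ∈ W, φ z ≠ 0) ∧ ∀ z ∉ W, ψ z ≠ 0 := by
  obtain ⟨𝒱, hfin, hopen, hcov, href, hord⟩ := hZ {{z | φ z ≠ 0}, {z | ψ z ≠ 0}} (by simp)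
    (by
      rintro U (rfl | rfl)
      exacts [⟨φ, rfl⟩, ⟨ψ, rfl⟩])
    (by
      refine eq_univ_of_forall fun z => ?_
      rcases h z with hz | hz
      exacts [⟨_, Or.inl rfl, hz⟩, ⟨_, Or.inr rfl, hz⟩])
  have hVopen : ∀ V ∈ 𝒱, IsOpen V := by
    intro V hV
    obtain ⟨χ, rfl⟩ := hopen V hV
    exact isOpen_ne_fun χ.continuous continuous_const
  have huniq : ∀ z, ∀ V ∈ 𝒱, ∀ V' ∈ 𝒱, z ∈ V → z ∈ V' → V = V' := fun z V hV V' hV' hz hz' =>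
    (ncard_le_one (hfin.subset fun V hV => hV.1)).1 (hord z) V ⟨hV, hz⟩ V' ⟨hV', hz'⟩
  let P : Set Z → Prop := fun V => ∀ z ∈ V, φ z ≠ 0
  have hc : (⋃ V ∈ {V | V ∈ 𝒱 ∧ P V}, V)ᶜ = ⋃ V ∈ {V | V ∈ 𝒱 ∧ ¬ P V}, V := by
    ext z
    obtain ⟨V, hV, hzV⟩ := mem_sUnion.1 (hcov.symm ▸ mem_univ z)
    constructor
    · intro hz
      exact mem_iUnion₂.2 ⟨V, ⟨hV, fun hP => hz (mem_iUnion₂.2 ⟨V, ⟨hV, hP⟩, hzV⟩)⟩, hzV⟩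
    · intro hz hz'
      obtain ⟨V₁, hV₁, hz₁⟩ := mem_iUnion₂.1 hz
      obtain ⟨V₂, hV₂, hz₂⟩ := mem_iUnion₂.1 hz'
      exact hV₁.2 (huniq z V₁ hV₁.1 V₂ hV₂.1 hz₁ hz₂ ▸ hV₂.2)
  refine ⟨⋃ V ∈ {V | V ∈ 𝒱 ∧ P V}, V,
    ⟨⟨hc ▸ isOpen_biUnion fun V hV => hVopen V hV.1⟩,
      isOpen_biUnion fun V hV => hVopen V hV.1⟩, ?_, ?_⟩
  · intro z hz
    obtain ⟨V, hV, hzV⟩ := mem_iUnion₂.1 hz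
    exact hV.2 z hzV
  · intro z hz
    rw [← mem_compl_iff, hc] at hz
    obtain ⟨V, hV, hzV⟩ := mem_iUnion₂.1 hz
    obtain ⟨U, rfl | rfl, hVU⟩ := href V hV.1
    · exact (hV.2 hVU).elim
    · exact hVU hzV

theorem eventually_round_eq {x : ℝ} (hx : |x - round x| < 1 / 2) :
    ∀ᶠ y : ℝ in 𝓝 x, round y = round x := by
  have : ∀ᶠ y : ℝ in 𝓝 x, |y - round x| < 1 / 2 :=
    ((continuous_id.sub continuous_const).abs.tendsto x).eventually (gt_mem_nhds hx)
  filter_upwards [this] with y hy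
  rw [round_eq, Int.floor_eq_iff]
  rw [abs_lt] at hy
  constructor <;> linarith

theorem abs_sub_round_lt_of_cos_ne_zero {x : ℝ} (hx : Real.cos (Real.pi * x) ≠ 0) :
    |x - round x| < 1 / 2 := by
  refine lt_of_le_of_ne (abs_sub_round x) fun h => hx ?_
  rw [Real.cos_eq_zero_iff]
  rcases (abs_eq (by norm_num)).1 h with h | h
  · exact ⟨round x, by linear_combination Real.pi * h⟩
  · exact ⟨round x - 1, by push_cast; linear_combination Real.pi * h⟩

/-- A continuous real-valued function on a zero-dimensional space can be approximated, up to a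
distance of one, by a continuous integer-valued function. -/
theorem LebesgueDimLE.exists_continuous_int {Z : Type u} [TopologicalSpace Z]
    (hZ : LebesgueDimLE 0 Z) (φ : C(Z, ℝ)) :
    ∃ c : Z → ℤ, Continuous c ∧ ∀ z, |φ z - c z| ≤ 1 := by
  classical
  -- The first function vanishes where `φ` is an odd integer, the second where it is an even one.
  -- Rounding to the nearest even integer on `W` and to the nearest odd integer off `W` therefore
  -- never meets a jump, and errs by at most 1.
  obtain ⟨W, hW, hW₀, hW₁⟩ := hZ.exists_isClopen
    ⟨fun z => Real.cos (Real.pi * (φ z / 2)), by fun_prop⟩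
    ⟨fun z => Real.cos (Real.pi * ((φ z - 1) / 2)), by fun_prop⟩ (by
      intro z
      simp only [ContinuousMap.coe_mk]
      rw [show Real.pi * ((φ z - 1) / 2) = Real.pi * (φ z / 2) - Real.pi / 2 by ring,
        Real.cos_sub_pi_div_two]
      by_contra! h
      have := Real.sin_sq_add_cos_sq (Real.pi * (φ z / 2))
      simp [h.1, h.2] at this)
  have hloc : ∀ (f : Z → ℝ) (hf : Continuous f) (z : Z), Real.cos (Real.pi * f z) ≠ 0 →
      ContinuousAt (fun w => round (f w)) z := fun f hf z hz =>
    (continuousAt_const (y := round (f z))).congr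
      ((hf.continuousAt.eventually
        (eventually_round_eq (abs_sub_round_lt_of_cos_ne_zero hz))).mono fun w hw => hw.symm)
  refine ⟨W.piecewise (fun z => 2 * round (φ z / 2)) (fun z => 2 * round ((φ z - 1) / 2) + 1),
    continuous_iff_continuousAt.2 fun z => ?_, fun z => ?_⟩
  · by_cases hz : z ∈ W
    · refine ContinuousAt.congr (f := fun z => 2 * round (φ z / 2)) ?_ ?_
      · exact continuousAt_const.mul (hloc (fun z => φ z / 2) (by fun_prop) z (hW₀ z hz))
      · filter_upwards [hW.isOpen.mem_nhds hz] with w hw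
        rw [piecewise_eq_of_mem _ _ _ hw]
    · refine ContinuousAt.congr (f := fun z => 2 * round ((φ z - 1) / 2) + 1) ?_ ?_
      · exact (continuousAt_const.mul
          (hloc (fun z => (φ z - 1) / 2) (by fun_prop) z (hW₁ z hz))).add continuousAt_const
      · filter_upwards [hW.compl.isOpen.mem_nhds hz] with w hw
        rw [piecewise_eq_of_notMem _ _ _ hw]
  · by_cases hz : z ∈ W
    · rw [piecewise_eq_of_mem _ _ _ hz]
      have := abs_le.1 (abs_sub_round (φ z / 2))
      rw [abs_le]
      push_cast
      constructor <;> linarith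
    · rw [piecewise_eq_of_notMem _ _ _ hz]
      have := abs_le.1 (abs_sub_round ((φ z - 1) / 2))
      rw [abs_le]
      push_cast
      constructor <;> linarith

/-! ### Dyadic codes of real numbers -/

/-- The space of dyadic codes of real numbers: sequences of integers together with the real number
which they approximate. -/
abbrev DyadicCode : Type := ({b | ∀ n : ℕ, |2 ^ n * b.2 - b.1 n| ≤ 1} : Set ((ℕ → ℤ) × ℝ))

namespace DyadicCode

/-- The real number with a given code. -/
abbrev val (b : DyadicCode) : ℝ := b.1.2

theorem continuous_val : Continuous val := continuous_snd.comp continuous_subtype_val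

/-- A code of `y`, chosen to be close to the nearest-integer code of `x` when `y` is close
to `x`. -/
noncomputable def near (x y : ℝ) : DyadicCode :=
  ⟨(fun n => if |2 ^ n * y - round (2 ^ n * x)| ≤ 1 then round (2 ^ n * x) else round (2 ^ n * y),
    y), fun n => by
      dsimp only
      split_ifs with h
      · exact h
      · exact (abs_sub_round _).trans (by norm_num)⟩

@[simp] theorem val_near (x y : ℝ) : (near x y).val = y := rfl

/-- Rounding errs by at most 1/2 while a code tolerates 1, so each rounded multiple of `x` stays
admissible for all `y` near `x`. Continuity at the single point `x` is the goal: a continuous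
section of `val` on the connected line is impossible. -/
theorem continuousAt_near (x : ℝ) : ContinuousAt (near x) x := by
  rw [IsInducing.subtypeVal.continuousAt_iff]
  refine ContinuousAt.prodMk (continuousAt_pi.2 fun n => ?_) continuousAt_id
  have h : ∀ᶠ y : ℝ in 𝓝 x, |2 ^ n * y - round (2 ^ n * x)| < 1 :=
    (Continuous.tendsto (f := fun y : ℝ => |2 ^ n * y - round (2 ^ n * x)|)
      (by fun_prop) x).eventually
      (gt_mem_nhds ((abs_sub_round (2 ^ n * x)).trans_lt (by norm_num)))
  refine (continuousAt_const (y := round (2 ^ n * x))).congr ?_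
  filter_upwards [h] with y hy
  simp [hy.le]

instance : SecondCountableTopology DyadicCode := inferInstance

instance : Nonempty DyadicCode := ⟨near 0 0⟩

/-- Integer approximations to the functions 2^n φ are the digits of the lift. -/
theorem exists_lift {Z : Type u} [TopologicalSpace Z] (hZ : LebesgueDimLE 0 Z) (φ : C(Z, ℝ)) :
    ∃ h : Z → DyadicCode, Continuous h ∧ ∀ z, (h z).val = φ z := by
  choose c hc hφc using fun n : ℕ =>
    hZ.exists_continuous_int ⟨fun z => 2 ^ n * φ z, by fun_prop⟩
  exact ⟨fun z => ⟨(fun n => c n z, φ z), fun n => hφc n z⟩,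
    ((continuous_pi hc).prodMk φ.continuous).subtype_mk _, fun z => rfl⟩

theorem exists_lift_pi {Z ι : Type u} [TopologicalSpace Z] (hZ : LebesgueDimLE 0 Z)
    {p : Z → ι → ℝ} (hp : Continuous p) :
    ∃ h : Z → ι → DyadicCode, Continuous h ∧ ∀ z i, (h z i).val = p z i := by
  choose h hh hhp using fun i : ι =>
    exists_lift hZ ⟨fun z => p z i, (continuous_apply i).comp hp⟩
  exact ⟨fun z i => h i z, continuous_pi hh, fun z i => hhp i z⟩

/-- Codes of a family of real numbers, see `DyadicCode.near`. -/
noncomputable def nearPi {ι : Type*} (x y : ι → ℝ) (i : ι) : DyadicCode := near (x i) (y i)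

theorem continuousAt_nearPi {ι : Type*} (x : ι → ℝ) : ContinuousAt (nearPi x) x :=
  continuousAt_pi.2 fun i =>
    (continuousAt_near (x i)).comp (f := fun y : ι → ℝ => y i) (continuous_apply i).continuousAt

/-- A code has arbitrarily small clopen neighbourhoods. -/
theorem exists_isClopen_nhds (b : DyadicCode) {U : Set DyadicCode} (hU : U ∈ 𝓝 b) :
    ∃ V, IsClopen V ∧ b ∈ V ∧ V ⊆ U := by
  rw [nhds_subtype, mem_comap, nhds_prod_eq] at hU
  obtain ⟨t, ht, htU⟩ := hU
  obtain ⟨t₁, ht₁, t₂, ht₂, hsub⟩ := mem_prod_iff.1 ht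
  rw [nhds_pi, Filter.mem_pi] at ht₁
  obtain ⟨I, hI, s, hs, hIs⟩ := ht₁
  obtain ⟨ε, hε, hball⟩ := Metric.mem_nhds_iff.1 ht₂
  -- Two codes with the same digit at `n` have values within 2/2^n of each other, which is less than
  -- `ε`.
  obtain ⟨n, hn⟩ := exists_pow_lt_of_lt_one (half_pos hε) (one_half_lt_one (α := ℝ))
  have hcode : ∀ m : ℕ, Continuous fun b : DyadicCode => b.1.1 m := fun m =>
    (continuous_apply m).comp (continuous_fst.comp continuous_subtype_val)
  have hclopen : ∀ m : ℕ, IsClopen {b' : DyadicCode | b'.1.1 m = b.1.1 m} := fun m =>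
    (isClopen_discrete {b.1.1 m}).preimage (hcode m)
  refine ⟨⋂ m ∈ insert n I, {b' | b'.1.1 m = b.1.1 m},
    (hI.insert n).isClopen_biInter fun m _ => hclopen m, mem_iInter₂.2 fun m _ => rfl, ?_⟩
  intro b' hb'
  have hb' : ∀ m ∈ insert n I, b'.1.1 m = b.1.1 m := fun m hm => mem_iInter₂.1 hb' m hm
  refine htU (hsub ⟨hIs fun i hi => ?_, hball ?_⟩)
  · rw [hb' i (mem_insert_of_mem _ hi)]
    exact mem_of_mem_nhds (hs i)
  · have h₁ := abs_le.1 (b.2 n)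
    have h₂ := abs_le.1 (b'.2 n)
    rw [hb' n (mem_insert _ _)] at h₂
    have hpos : (0 : ℝ) < 2 ^ n := by positivity
    have hn' : 2 < 2 ^ n * ε := by
      rw [one_div, inv_pow, inv_lt_iff_one_lt_mul₀ hpos] at hn
      linarith
    rw [Metric.mem_ball, Real.dist_eq, abs_lt]
    constructor <;> nlinarith

theorem lebesgueDimLE_zero_pi (ι : Type u) : LebesgueDimLE 0 (ι → DyadicCode) := by
  refine _root_.lebesgueDimLE_zero_pi fun S hS => ?_
  have := hS.to_subtype
  refine lebesgueDimLE_zero_of_isClopen_nhds fun z U hU hz => ?_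
  have := hU.mem_nhds hz
  rw [nhds_pi, Filter.mem_pi] at this
  obtain ⟨I, hI, t, ht, hsub⟩ := this
  choose V hV hzV hVt using fun i => exists_isClopen_nhds (z i) (ht i)
  refine ⟨I.pi V, ⟨isClosed_set_pi fun i _ => (hV i).isClosed,
    isOpen_set_pi hI fun i _ => (hV i).isOpen⟩, fun i _ => hzV i, ?_⟩
  exact (pi_mono fun i _ => hVt i).trans hsub

end DyadicCode

/-! ### Closed embeddings and decodings -/

/-- A map which admits, for each point of the codomain, a left inverse continuous at that point is
a closed embedding. -/
theorem isClosedEmbedding_of_forall_exists_leftInverse {Y P : Type*} [TopologicalSpace Y]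
    [TopologicalSpace P] [T2Space P] {j : Y → P} (hj : Continuous j)
    (h : ∀ p, ∃ t : P → Y, ContinuousAt t p ∧ Function.LeftInverse t j) :
    IsClosedEmbedding j := by
  refine ⟨⟨isInducing_iff_nhds.2 fun y => le_antisymm hj.continuousAt.le_comap ?_, ?_⟩, ?_⟩
  · obtain ⟨t, ht, htj⟩ := h (j y)
    intro U hU
    refine ⟨t ⁻¹' U, ht (by rwa [htj y]), ?_⟩
    rw [← preimage_comp, htj.comp_eq_id, preimage_id]
  · intro y y' hy
    obtain ⟨t, -, htj⟩ := h (j y)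
    exact htj.injective hy
  · refine isClosed_of_closure_subset fun p hp => ?_
    obtain ⟨t, ht, htj⟩ := h p
    have := mem_closure_iff_nhdsWithin_neBot.1 hp
    -- On the range `j ∘ t` is the identity, so along the range it tends at `p` both to `j (t p)`
    -- and to `p`.
    have h₁ : Tendsto (fun q => j (t q)) (𝓝[range j] p) (𝓝 (j (t p))) :=
      (hj.tendsto _).comp (ht.mono_left nhdsWithin_le_nhds)
    have h₂ : Tendsto (fun q => j (t q)) (𝓝[range j] p) (𝓝 p) := by
      refine (tendsto_id.mono_left nhdsWithin_le_nhds).congr' ?_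
      filter_upwards [self_mem_nhdsWithin]
      rintro _ ⟨y, rfl⟩
      exact congrArg j (htj y).symm
    exact ⟨t p, tendsto_nhds_unique h₁ h₂⟩

/-- A continuous map from the codes of families of reals indexed by `C(X)` to `X` which sends every
code of the family of values at a point to that point. -/
structure IsDecoding {X : Type u} [TopologicalSpace X] (k : (C(X, ℝ) → DyadicCode) → X) :
    Prop where
  continuous : Continuous k
  apply_eq : ∀ z x, (∀ φ, (z φ).val = φ x) → k z = x

theorem eq_of_forall_continuousMap_eq {X : Type*} [TopologicalSpace X] [T35Space X] {x y : X}
    (h : ∀ φ : C(X, ℝ), φ x = φ y) : x = y := by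
  by_contra hne
  obtain ⟨f, hf, hxy⟩ := separatesPoints_continuous_of_t35Space (X := X) hne
  exact hxy (h ⟨f, hf⟩)

/-- The map from codes of evaluation families to points is extended from `Z₀` to the whole power.
Its composite with `φ` extends because it is the value of coordinate `φ`. -/
theorem IsAE.exists_isDecoding {X : Type u} [TopologicalSpace X] (hX : IsAE 0 X) :
    ∃ k : (C(X, ℝ) → DyadicCode) → X, IsDecoding k := by
  have := hX.tychonov
  let Z₀ : Set (C(X, ℝ) → DyadicCode) := {z | ∃ x, ∀ φ, (z φ).val = φ x}
  choose f hf using fun z : Z₀ => z.2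
  have hval : ∀ φ, Continuous fun z : C(X, ℝ) → DyadicCode => (z φ).val := fun φ =>
    DyadicCode.continuous_val.comp (continuous_apply φ)
  have hfc : Continuous f := continuous_iff_forall_comp.2 fun φ => by
    exact ((hval φ).comp continuous_subtype_val).congr fun z => hf z φ
  obtain ⟨k, hk⟩ := hX.exists_extension _ (DyadicCode.lebesgueDimLE_zero_pi C(X, ℝ)) Z₀ ⟨f, hfc⟩
    fun φ => ⟨⟨_, hval φ⟩, fun z => hf z φ⟩
  refine ⟨k, k.continuous, fun z x hz => ?_⟩
  have hz₀ : z ∈ Z₀ := ⟨x, hz⟩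
  rw [hk ⟨z, hz₀⟩]
  exact eq_of_forall_continuousMap_eq fun φ => (hf ⟨z, hz₀⟩ φ).symm.trans (hz φ)

/-! ### Closed sets of functions and their normal subgroups -/

variable {G : Type u} [Group G] [TopologicalSpace G]

/-- A set `S` of functions on `G` is closed for a decoding `k` if the value of each member of `S`
at a product `k z * k w` depends only on the coordinates of `z` and `w` in `S`. -/
def IsClosedUnder (k : (C(G, ℝ) → DyadicCode) → G) (S : Set C(G, ℝ)) : Prop :=
  ∀ φ ∈ S, ∀ z z' w w', EqOn z z' S → EqOn w w' S → φ (k z * k w) = φ (k z' * k w')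

namespace IsClosedUnder

variable {k : (C(G, ℝ) → DyadicCode) → G} {S : Set C(G, ℝ)}

protected theorem univ : IsClosedUnder k univ := fun φ _ z z' w w' hz hw => by
  rw [(eqOn_univ _ _).1 hz, (eqOn_univ _ _).1 hw]

protected theorem sUnion {C : Set (Set C(G, ℝ))} (hC : ∀ S ∈ C, IsClosedUnder k S) :
    IsClosedUnder k (⋃₀ C) := by
  rintro φ ⟨S, hS, hφ⟩ z z' w w' hz hw
  exact hC S hS φ hφ z z' w w' (hz.mono (subset_sUnion_of_mem hS))
    (hw.mono (subset_sUnion_of_mem hS))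

theorem exists_countable_superset [IsTopologicalGroup G] (hk : IsDecoding k)
    (hS : S.Countable) : ∃ T, S ⊆ T ∧ T.Countable ∧ IsClosedUnder k T := by
  have hdep : ∀ φ : C(G, ℝ), ∃ T : Set C(G, ℝ), T.Countable ∧ DependsOn
      (fun z : C(G, ℝ) → DyadicCode × DyadicCode =>
        φ (k (fun i => (z i).1) * k (fun i => (z i).2))) T := fun φ =>
    Continuous.exists_countable_dependsOn <| φ.continuous.comp <|
      (hk.continuous.comp (by fun_prop)).mul (hk.continuous.comp (by fun_prop))
  choose supp hsupp hφ using hdep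
  obtain ⟨T, hST, hT, hcl⟩ := exists_countable_superset_closed
    (fun F : Finset C(G, ℝ) => ⋃ φ ∈ F, supp φ)
    (fun F => F.countable_toSet.biUnion fun φ _ => hsupp φ) hS
  refine ⟨T, hST, hT, fun φ hφT z z' w w' hz hw => ?_⟩
  refine hφ φ (x := fun i => (z i, w i)) (y := fun i => (z' i, w' i)) fun i hi => ?_
  -- The closing-off operation is indexed by finite sets; singletons suffice here.
  have : i ∈ T := hcl {φ} (by simpa using hφT) (by simpa using hi)
  exact Prod.ext (hz this) (hw this)

/-- Off `S`, the coordinates of `z` can be replaced by those of a code of `x`, after which it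
decodes to `x`. Taking a code of 1 as second factor turns closedness for products into the claim. -/
theorem apply_decode_eq (hS : IsClosedUnder k S) (hk : IsDecoding k)
    {z : C(G, ℝ) → DyadicCode} {x : G} (h : ∀ φ ∈ S, (z φ).val = φ x) {φ : C(G, ℝ)}
    (hφ : φ ∈ S) : φ (k z) = φ x := by
  classical
  let c : G → C(G, ℝ) → DyadicCode := fun x => DyadicCode.nearPi 0 fun φ => φ x
  have hc : ∀ x, k (c x) = x := fun x => hk.apply_eq _ _ fun φ => rfl
  have h₁ : k (S.piecewise z (c x)) = x := hk.apply_eq _ _ fun ψ => by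
    by_cases hψ : ψ ∈ S
    · rw [piecewise_eq_of_mem _ _ _ hψ, h ψ hψ]
    · rw [piecewise_eq_of_notMem _ _ _ hψ]; rfl
  have := hS φ hφ z (S.piecewise z (c x)) (c 1) (c 1)
    (fun ψ hψ => (piecewise_eq_of_mem _ _ _ hψ).symm) fun _ _ => rfl
  simpa only [hc, h₁, mul_one] using this

/-- If `x` and `x'` agree on `S`, a code of `x` altered off `S` is a code of `x'`. -/
theorem mul_congr (hS : IsClosedUnder k S) (hk : IsDecoding k) {x x' y y' : G}
    (hx : ∀ φ ∈ S, φ x = φ x') (hy : ∀ φ ∈ S, φ y = φ y') :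
    ∀ φ ∈ S, φ (x * y) = φ (x' * y') := by
  classical
  let c : G → C(G, ℝ) → DyadicCode := fun x => DyadicCode.nearPi 0 fun φ => φ x
  have hc : ∀ x, k (c x) = x := fun x => hk.apply_eq _ _ fun φ => rfl
  have hpw : ∀ x x' : G, (∀ φ ∈ S, φ x = φ x') → k (S.piecewise (c x) (c x')) = x' :=
    fun x x' h => hk.apply_eq _ _ fun ψ => by
      by_cases hψ : ψ ∈ S
      · rw [piecewise_eq_of_mem _ _ _ hψ]; exact h ψ hψ
      · rw [piecewise_eq_of_notMem _ _ _ hψ]; rfl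
  intro φ hφ
  have := hS φ hφ (c x) (S.piecewise (c x) (c x')) (c y) (S.piecewise (c y) (c y'))
    (fun ψ hψ => (piecewise_eq_of_mem _ _ _ hψ).symm)
    (fun ψ hψ => (piecewise_eq_of_mem _ _ _ hψ).symm)
  simpa only [hc, hpw x x' hx, hpw y y' hy] using this

/-- Closedness mentions only products, but inverses follow by comparing y⁻¹xx⁻¹ with y⁻¹yx⁻¹. -/
theorem inv_congr (hS : IsClosedUnder k S) (hk : IsDecoding k) {x y : G}
    (h : ∀ φ ∈ S, φ x = φ y) : ∀ φ ∈ S, φ x⁻¹ = φ y⁻¹ := by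
  have h₁ := hS.mul_congr hk (hS.mul_congr hk (fun φ _ => rfl : ∀ φ ∈ S, φ y⁻¹ = φ y⁻¹) h)
    (fun φ _ => rfl : ∀ φ ∈ S, φ x⁻¹ = φ x⁻¹)
  intro φ hφ
  simpa [eq_comm] using h₁ φ hφ

/-- The subgroup of elements which the members of a closed set of functions do not distinguish
from `1`. -/
def subgroup (hS : IsClosedUnder k S) (hk : IsDecoding k) : Subgroup G where
  carrier := {x | ∀ φ ∈ S, φ x = φ 1}
  one_mem' := fun _ _ => rfl
  mul_mem' := fun {x y} hx hy φ hφ => by simpa using hS.mul_congr hk hx hy φ hφ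
  inv_mem' := fun {x} hx φ hφ => by simpa using hS.inv_congr hk hx φ hφ

theorem mem_subgroup (hS : IsClosedUnder k S) (hk : IsDecoding k) {x : G} :
    x ∈ hS.subgroup hk ↔ ∀ φ ∈ S, φ x = φ 1 := Iff.rfl

instance normal_subgroup (hS : IsClosedUnder k S) (hk : IsDecoding k) :
    (hS.subgroup hk).Normal where
  conj_mem x hx g φ hφ := by
    have h := hS.mul_congr hk (hS.mul_congr hk (fun φ _ => rfl : ∀ φ ∈ S, φ g = φ g) hx)
      (fun φ _ => rfl : ∀ φ ∈ S, φ g⁻¹ = φ g⁻¹)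
    simpa using h φ hφ

theorem mk_eq_mk_iff (hS : IsClosedUnder k S) (hk : IsDecoding k) {x y : G} :
    (x : G ⧸ hS.subgroup hk) = y ↔ ∀ φ ∈ S, φ x = φ y := by
  rw [QuotientGroup.eq, mem_subgroup]
  refine ⟨fun h φ hφ => ?_, fun h φ hφ => ?_⟩
  · have := hS.mul_congr hk (fun φ _ => rfl : ∀ φ ∈ S, φ x = φ x) h φ hφ
    simpa [eq_comm] using this
  · have := hS.mul_congr hk (fun φ _ => rfl : ∀ φ ∈ S, φ x⁻¹ = φ x⁻¹) h φ hφ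
    simpa [eq_comm] using this

end IsClosedUnder

/-! ### Extension, softness and closed embeddings of coordinatized images -/

/-- A continuous surjection of `G` onto a space is coordinatized by a set `S` of functions on `G`
if the members of `S` factor continuously through it and distinguish its fibres. -/
structure IsCoordinatizedBy {G : Type u} [TopologicalSpace G] {Y : Type u} [TopologicalSpace Y] (r : G → Y) (S : Set C(G, ℝ)) :
    Prop where
  continuous : Continuous r
  surjective : Function.Surjective r
  eq_of_forall_eq : ∀ x y, (∀ φ ∈ S, φ x = φ y) → r x = r y
  exists_factor : ∀ φ ∈ S, ∃ ψ : C(Y, ℝ), ∀ x, ψ (r x) = φ x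

/-- This lets `G` itself be the source in `IsCoordinatizedBy.isSoft`, so limit projections and short
projections are treated alike. -/
theorem isCoordinatizedBy_id {G : Type u} [TopologicalSpace G] [T35Space G] : IsCoordinatizedBy (id : G → G) univ where
  continuous := continuous_id
  surjective := Function.surjective_id
  eq_of_forall_eq _ _ h := eq_of_forall_continuousMap_eq fun φ => h φ (mem_univ φ)
  exists_factor φ _ := ⟨φ, fun _ => rfl⟩

theorem IsClosedUnder.isCoordinatizedBy_mk {k : (C(G, ℝ) → DyadicCode) → G} {S : Set C(G, ℝ)}
    (hS : IsClosedUnder k S) (hk : IsDecoding k) :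
    IsCoordinatizedBy (QuotientGroup.mk : G → G ⧸ hS.subgroup hk) S where
  continuous := QuotientGroup.continuous_mk
  surjective := QuotientGroup.mk_surjective
  eq_of_forall_eq _ _ h := (hS.mk_eq_mk_iff hk).2 h
  exists_factor φ hφ :=
    ⟨⟨Quotient.lift φ fun _ _ hxy => (hS.mk_eq_mk_iff hk).1 (Quotient.sound hxy) φ hφ,
      φ.continuous.quotient_lift _⟩, fun _ => rfl⟩

/-- Families of reals depending continuously on a point of a zero-dimensional space decode to a
continuous map into `G`. -/
theorem IsDecoding.exists_lift {k : (C(G, ℝ) → DyadicCode) → G} (hk : IsDecoding k)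
    {Z : Type u} [TopologicalSpace Z] (hZ : LebesgueDimLE 0 Z) {p : Z → C(G, ℝ) → ℝ}
    (hp : Continuous p) :
    ∃ κ : C(Z, G), ∀ S, IsClosedUnder k S → ∀ z x, (∀ φ ∈ S, p z φ = φ x) →
      ∀ φ ∈ S, φ (κ z) = φ x := by
  obtain ⟨h, hh, hhp⟩ := DyadicCode.exists_lift_pi hZ hp
  exact ⟨⟨fun z => k (h z), hk.continuous.comp hh⟩, fun S hS z x hzx φ hφ =>
    hS.apply_decode_eq hk (fun ψ hψ => (hhp z ψ).trans (hzx ψ hψ)) hφ⟩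

namespace IsCoordinatizedBy

variable {k : (C(G, ℝ) → DyadicCode) → G} {S S' : Set C(G, ℝ)} {Y Y' : Type u}
  [TopologicalSpace Y] [TopologicalSpace Y'] {r : G → Y} {r' : G → Y'}

theorem isAE [T35Space Y] (hr : IsCoordinatizedBy r S) (hS : IsClosedUnder k S)
    (hk : IsDecoding k) : IsAE 0 Y := by
  classical
  refine ⟨inferInstance, fun Z _ _ hZ Z₀ f hf => ?_⟩
  -- Outside `S` the function `c φ` is arbitrary; such coordinates only need to be continuous.
  choose! c hc using hr.exists_factor
  choose e he using fun φ => hf (c φ)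
  let p : Z → C(G, ℝ) → ℝ := fun z φ => e φ z
  have hp : Continuous p := continuous_pi fun φ => (e φ).continuous
  obtain ⟨κ, hκ⟩ := hk.exists_lift hZ hp
  refine ⟨⟨fun z => r (κ z), hr.continuous.comp κ.continuous⟩, fun z => ?_⟩
  obtain ⟨x, hx⟩ := hr.surjective (f z)
  simp only [ContinuousMap.coe_mk]
  rw [← hx]
  refine hr.eq_of_forall_eq _ _ (hκ S hS z x fun φ hφ => ?_)
  simp only [p]
  rw [he, ← hx, hc φ hφ]

/-- Coordinates in `S` are dictated on all of `Z` by `h`; the others are extended from `g`. Over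
`Z₀` the two prescriptions are compatible since `f ∘ g = h`, so a single decoded map into `G` serves
both `S` and `S'`. -/
theorem isSoft [T35Space Y] [T35Space Y'] (hr : IsCoordinatizedBy r S)
    (hr' : IsCoordinatizedBy r' S') (hS : IsClosedUnder k S) (hS' : IsClosedUnder k S')
    (hk : IsDecoding k) {f : Y' → Y} (hf : Continuous f) (hfr : ∀ x, f (r' x) = r x) :
    IsSoft 0 f := by
  classical
  refine ⟨hf, hr'.isAE hS' hk, hr.isAE hS hk, fun Z _ _ hZ _ Z₀ _ g h hgh hg => ?_⟩
  choose! c hc using hr.exists_factor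
  choose! c' hc' using hr'.exists_factor
  choose e he using fun φ => hg (c' φ)
  let p : Z → C(G, ℝ) → ℝ := fun z φ => if φ ∈ S then c φ (h z) else e φ z
  have hp : Continuous p := continuous_pi fun φ => by
    by_cases hφ : φ ∈ S
    · simp only [p, if_pos hφ]; fun_prop
    · simp only [p, if_neg hφ]; fun_prop
  obtain ⟨κ, hκ⟩ := hk.exists_lift hZ hp
  refine ⟨⟨fun z => r' (κ z), hr'.continuous.comp κ.continuous⟩, fun z => ?_, fun z => ?_⟩
  · obtain ⟨x, hx⟩ := hr'.surjective (g z)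
    simp only [ContinuousMap.coe_mk]
    rw [← hx]
    refine hr'.eq_of_forall_eq _ _ (hκ S' hS' z x fun φ hφ => ?_)
    by_cases hφS : φ ∈ S
    · simp only [p, if_pos hφS]
      rw [← hgh, ← hx, hfr, hc φ hφS]
    · simp only [p, if_neg hφS]
      rw [he, ← hx, hc' φ hφ]
  · obtain ⟨x, hx⟩ := hr.surjective (h z)
    simp only [ContinuousMap.coe_mk]
    rw [← hx, hfr]
    refine hr.eq_of_forall_eq _ _ (hκ S hS z x fun φ hφ => ?_)
    simp only [p, if_pos hφ]
    rw [← hx, hc φ hφ]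

/-- Coding a family of reals, decoding and projecting gives a left inverse. `DyadicCode.near` makes
it continuous at any one prescribed point, which is enough for a closed embedding. -/
theorem exists_isClosedEmbedding (hr : IsCoordinatizedBy r S) (hS : IsClosedUnder k S)
    (hk : IsDecoding k) :
    ∃ j : Y → S → ℝ, IsClosedEmbedding j ∧ ∀ x φ, j (r x) φ = φ.1 x := by
  classical
  choose c hc using fun φ : S => hr.exists_factor φ φ.2
  refine ⟨fun y φ => c φ y, ?_, fun x φ => hc φ x⟩
  refine isClosedEmbedding_of_forall_exists_leftInverse
    (continuous_pi fun φ => (c φ).continuous) fun q => ?_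
  let ext : (S → ℝ) → C(G, ℝ) → ℝ := fun q φ => if h : φ ∈ S then q ⟨φ, h⟩ else 0
  have hext : Continuous ext := continuous_pi fun φ => by
    by_cases hφ : φ ∈ S
    · simpa only [ext, dif_pos hφ] using continuous_apply _
    · simpa only [ext, dif_neg hφ] using continuous_const
  refine ⟨fun q' => r (k (DyadicCode.nearPi (ext q) (ext q'))), ?_, fun y => ?_⟩
  · exact (hr.continuous.comp hk.continuous).continuousAt.comp
      ((DyadicCode.continuousAt_nearPi (ext q)).comp hext.continuousAt)
  · obtain ⟨x, rfl⟩ := hr.surjective y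
    refine hr.eq_of_forall_eq _ _ fun φ hφ => hS.apply_decode_eq hk (fun ψ hψ => ?_) hφ
    simp [DyadicCode.nearPi, ext, hψ, hc]

theorem polishSpace (hr : IsCoordinatizedBy r S) (hS : IsClosedUnder k S) (hk : IsDecoding k)
    (hcount : S.Countable) : PolishSpace Y := by
  have := hcount.to_subtype
  obtain ⟨j, hj, -⟩ := hr.exists_isClosedEmbedding hS hk
  exact hj.polishSpace

theorem t35Space (hr : IsCoordinatizedBy r S) (hS : IsClosedUnder k S) (hk : IsDecoding k) :
    T35Space Y := by
  obtain ⟨j, hj, -⟩ := hr.exists_isClosedEmbedding hS hk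
  exact hj.isEmbedding.t35Space

end IsCoordinatizedBy

/-! ### The spectrum of quotients -/

section GroupSpectrum

variable {G : Type u} [Group G] [TopologicalSpace G] {k : (C(G, ℝ) → DyadicCode) → G}

/-- The countable sets of functions closed for a decoding, ordered by inclusion. -/
abbrev CountableClosedSet (k : (C(G, ℝ) → DyadicCode) → G) : Type u :=
  {S : Set C(G, ℝ) // S.Countable ∧ IsClosedUnder k S}

theorem CountableClosedSet.isLUB_sUnion {C : Set (CountableClosedSet k)} (hC : C.Countable) :
    ∃ s : CountableClosedSet k, s.1 = ⋃ a ∈ C, a.1 ∧ IsLUB C s := by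
  have h : IsClosedUnder k (⋃ a ∈ C, a.1) := by
    rw [← sUnion_image]
    refine IsClosedUnder.sUnion ?_
    rintro _ ⟨a, -, rfl⟩
    exact a.2.2
  exact ⟨⟨_, hC.biUnion fun a _ => a.2.1, h⟩, rfl,
    fun a ha => subset_biUnion_of_mem (u := fun a : CountableClosedSet k => a.1) ha,
    fun b hb => iUnion₂_subset fun a ha => hb ha⟩

/-- Compatible families of elements of `G` are realized by single elements. -/
theorem IsDecoding.exists_forall_eq_of_directedOn (hk : IsDecoding k)
    {C : Set (CountableClosedSet k)} (hC : DirectedOn (· ≤ ·) C) (g : C → G)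
    (hg : ∀ a b : C, a ≤ b → ∀ φ ∈ a.1.1, φ (g b) = φ (g a)) :
    ∃ x, ∀ a : C, ∀ φ ∈ a.1.1, φ x = φ (g a) := by
  classical
  -- The member chosen for `φ` does not matter: any two have a common upper bound in `C`, where the
  -- values agree.
  let p : C(G, ℝ) → ℝ := fun φ => if h : ∃ a : C, φ ∈ a.1.1 then φ (g h.choose) else 0
  refine ⟨k (DyadicCode.nearPi 0 p), fun a φ hφ =>
    a.1.2.2.apply_decode_eq hk (fun ψ hψ => ?_) hφ⟩
  have h : ∃ a : C, ψ ∈ a.1.1 := ⟨a, hψ⟩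
  obtain ⟨c, hc, hac, hbc⟩ := hC a a.2 h.choose h.choose.2
  have : p ψ = ψ (g h.choose) := dif_pos h
  simp only [DyadicCode.nearPi, DyadicCode.val_near, this]
  rw [← hg a ⟨c, hc⟩ hac ψ hψ, ← hg h.choose ⟨c, hc⟩ hbc ψ h.choose_spec]

variable [IsTopologicalGroup G]

/-- The spectrum of the quotients of `G` by the subgroups attached to countable closed sets of
functions. -/
noncomputable def quotientSpectrum (hk : IsDecoding k) : GroupSpectrum (CountableClosedSet k) where
  group a := G ⧸ a.2.2.subgroup hk
  map {a b} h :=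
    { toMonoidHom := QuotientGroup.map _ _ (MonoidHom.id G) fun _ hx φ hφ => hx φ (h hφ)
      continuous_toFun := continuous_quot_lift _ QuotientGroup.continuous_mk }
  map_self a x := by
    obtain ⟨x, rfl⟩ := QuotientGroup.mk_surjective x
    rfl
  map_map hab hbc x := by
    obtain ⟨x, rfl⟩ := QuotientGroup.mk_surjective x
    rfl

namespace quotientSpectrum

/-- The projection of `G` onto a member of the spectrum of its quotients. -/
def proj (hk : IsDecoding k) (a : CountableClosedSet k) (x : G) : (quotientSpectrum hk).group a :=
  QuotientGroup.mk (s := a.2.2.subgroup hk) x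

theorem map_proj (hk : IsDecoding k) {a b : CountableClosedSet k} (h : a ≤ b) (x : G) :
    (quotientSpectrum hk).map h (proj hk b x) = proj hk a x := rfl

theorem isCoordinatizedBy_proj (hk : IsDecoding k) (a : CountableClosedSet k) :
    IsCoordinatizedBy (proj hk a) a.1 := a.2.2.isCoordinatizedBy_mk hk

theorem proj_eq_iff (hk : IsDecoding k) {a : CountableClosedSet k} {x y : G} :
    proj hk a x = proj hk a y ↔ ∀ φ ∈ a.1, φ x = φ y := a.2.2.mk_eq_mk_iff hk

theorem exists_proj_eq (hk : IsDecoding k) {C : Set (CountableClosedSet k)}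
    (hC : DirectedOn (· ≤ ·) C) (y : ∀ a : C, (quotientSpectrum hk).group a)
    (hy : ∀ (a b : C) (h : (a : CountableClosedSet k) ≤ b),
      (quotientSpectrum hk).map h (y b) = y a) :
    ∃ x, ∀ a : C, proj hk a x = y a := by
  choose g hg using fun a : C => (isCoordinatizedBy_proj hk a).surjective (y a)
  obtain ⟨x, hx⟩ := hk.exists_forall_eq_of_directedOn hC g fun a b h =>
    (proj_eq_iff hk).1 (by rw [hg, ← hy a b h, ← hg b, map_proj])
  exact ⟨x, fun a => by rw [← hg]; exact (proj_eq_iff hk).2 (hx a)⟩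

theorem t35Space (hk : IsDecoding k) (a : CountableClosedSet k) :
    T35Space ((quotientSpectrum hk).group a) :=
  (isCoordinatizedBy_proj hk a).t35Space a.2.2 hk

theorem polishSpace (hk : IsDecoding k) (a : CountableClosedSet k) :
    PolishSpace ((quotientSpectrum hk).group a) :=
  (isCoordinatizedBy_proj hk a).polishSpace a.2.2 hk a.2.1

/-- The supremum is the union of the chain, so each coordinate of the closed embedding of the
quotient at `s` already factors through a member of `C`. Surjectivity is decoding of compatible
families. -/
theorem isHomeomorph_diagonal (hk : IsDecoding k) {C : Set (CountableClosedSet k)}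
    (hC : IsChain (· ≤ ·) C) (hcount : C.Countable) {s : CountableClosedSet k} (hs : IsLUB C s) :
    IsHomeomorph ((quotientSpectrum hk).toInverseSpectrum.diagonal C s hs.1) := by
  obtain ⟨s', hs', hlub⟩ := CountableClosedSet.isLUB_sUnion hcount
  obtain rfl := hs.unique hlub
  set S := (quotientSpectrum hk).toInverseSpectrum
  have hmem : ∀ φ ∈ s.1, ∃ a : C, φ ∈ a.1.1 := by
    intro φ hφ
    obtain ⟨a, ha, hφa⟩ := mem_iUnion₂.1 (hs' ▸ hφ)
    exact ⟨⟨a, ha⟩, hφa⟩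
  have hdiag : Continuous (S.diagonal C s hs.1) :=
    (continuous_pi fun b => (S.map (hs.1 b.2)).continuous).subtype_mk _
  rw [isHomeomorph_iff_isEmbedding_surjective]
  constructor
  · obtain ⟨j, hj, hjx⟩ := (isCoordinatizedBy_proj hk s).exists_isClosedEmbedding s.2.2 hk
    choose a ha using fun φ : s.1 => hmem φ φ.2
    choose c hc using fun φ : s.1 => (isCoordinatizedBy_proj hk (a φ)).exists_factor φ (ha φ)
    let F : S.limitOn C → s.1 → ℝ := fun x φ => c φ (x.1 (a φ))
    have hF : Continuous F := continuous_pi fun φ =>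
      (c φ).continuous.comp ((continuous_apply (a φ)).comp continuous_subtype_val)
    refine IsEmbedding.of_comp hdiag hF ?_
    have hFj : F ∘ S.diagonal C s hs.1 = j := funext fun y => by
      obtain ⟨x, rfl⟩ := (isCoordinatizedBy_proj hk s).surjective y
      funext φ
      rw [hjx]
      exact hc φ x
    exact hFj ▸ hj.isEmbedding
  · intro x
    obtain ⟨g, hg⟩ := exists_proj_eq hk hC.directedOn x.1 x.2
    exact ⟨proj hk s g, Subtype.ext (funext hg)⟩

theorem isOmegaSpectrum (hk : IsDecoding k) :
    (quotientSpectrum hk).toInverseSpectrum.IsOmegaSpectrum where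
  nonempty := by
    -- The supremum of the empty family is an index.
    obtain ⟨s, -⟩ := CountableClosedSet.isLUB_sUnion (k := k) countable_empty
    exact ⟨s⟩
  directed a b := by
    obtain ⟨s, -, hs⟩ := CountableClosedSet.isLUB_sUnion ((countable_singleton b).insert a)
    exact ⟨s, hs.1 (by simp), hs.1 (by simp)⟩
  complete C _ hC := by
    obtain ⟨s, -, hs⟩ := CountableClosedSet.isLUB_sUnion hC
    exact ⟨s, hs⟩
  tychonov := t35Space hk
  countable_weight a := by
    have := polishSpace hk a
    exact this.toSecondCountableTopology
  continuous _ _ hC hcount _ hs := isHomeomorph_diagonal hk hC hcount hs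

theorem exists_mem (hk : IsDecoding k) (φ : C(G, ℝ)) : ∃ a : CountableClosedSet k, φ ∈ a.1 := by
  obtain ⟨T, hφ, hT, hcl⟩ := IsClosedUnder.exists_countable_superset hk (countable_singleton φ)
  exact ⟨⟨T, hT, hcl⟩, hφ rfl⟩

/-- The canonical isomorphism of `G` with the limit of the spectrum of its quotients. -/
theorem exists_continuousMulEquiv [T35Space G] (hk : IsDecoding k) :
    ∃ e : G ≃ₜ* (quotientSpectrum hk).limit, ∀ a x,
      (quotientSpectrum hk).limitProj a (e x) = proj hk a x := by
  let f : G →* (quotientSpectrum hk).limit :=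
    { toFun := fun x => ⟨fun a => proj hk a x, fun a b h => map_proj hk h x⟩
      map_one' := rfl
      map_mul' := fun _ _ => rfl }
  have hf : Continuous f :=
    (continuous_pi fun a => (isCoordinatizedBy_proj hk a).continuous).subtype_mk _
  have hinj : Function.Injective f := fun x y hxy =>
    eq_of_forall_continuousMap_eq fun φ => by
      obtain ⟨a, ha⟩ := exists_mem hk φ
      exact (proj_eq_iff hk).1 (congrFun (congrArg Subtype.val hxy) a) φ ha
  have hsurj : Function.Surjective f := by
    intro y
    have hdir : DirectedOn (· ≤ ·) (univ : Set (CountableClosedSet k)) := fun a _ b _ => by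
      obtain ⟨c, hc⟩ := (isOmegaSpectrum hk).directed a b
      exact ⟨c, mem_univ c, hc⟩
    obtain ⟨x, hx⟩ := exists_proj_eq hk hdir (fun a => y.1 a) fun a b h => y.2 a b h
    exact ⟨x, Subtype.ext (funext fun a => hx ⟨a, mem_univ a⟩)⟩
  let e := MulEquiv.ofBijective f ⟨hinj, hsurj⟩
  -- Each real function on `G` lies in some index, so its composite with the inverse factors through
  -- a limit projection.
  have he : Continuous e.symm := continuous_iff_forall_comp.2 fun φ => by
    obtain ⟨a, ha⟩ := exists_mem hk φ
    obtain ⟨ψ, hψ⟩ := (isCoordinatizedBy_proj hk a).exists_factor φ ha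
    refine (ψ.continuous.comp ((continuous_apply a).comp continuous_subtype_val)).congr fun y => ?_
    obtain ⟨x, rfl⟩ := e.surjective y
    rw [e.symm_apply_apply]
    exact hψ x
  exact ⟨{ e with continuous_toFun := hf, continuous_invFun := he }, fun a x => rfl⟩

theorem isFactorizing [T35Space G] (hk : IsDecoding k) :
    (quotientSpectrum hk).toInverseSpectrum.IsFactorizing := by
  intro φ
  obtain ⟨e, he⟩ := exists_continuousMulEquiv hk
  let e' : C(G, (quotientSpectrum hk).toInverseSpectrum.limit) := ⟨e, e.continuous_toFun⟩
  obtain ⟨a, ha⟩ := exists_mem hk (φ.comp e')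
  obtain ⟨ψ, hψ⟩ := (isCoordinatizedBy_proj hk a).exists_factor _ ha
  refine ⟨a, ψ, fun y => ?_⟩
  obtain ⟨x, rfl⟩ := e.surjective y
  exact (hψ x).symm.trans (congrArg ψ (he a x).symm)

end quotientSpectrum

end GroupSpectrum

theorem proposition3p1 {G : Type u} [Group G] [TopologicalSpace G] [IsTopologicalGroup G]
    (hG : IsAE 0 G) :
    ∃ (A : Type u) (_ : PartialOrder A) (S : GroupSpectrum A),
      S.toInverseSpectrum.IsOmegaSpectrum ∧
      S.toInverseSpectrum.IsFactorizing ∧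
      (∀ a : A, PolishSpace (S.group a)) ∧
      (∃ e : G ≃ₜ* S.limit, ∀ a : A, IsSoft 0 (fun g : G => S.limitProj a (e g))) ∧
      (∀ (a b : A) (h : a ≤ b), IsSoft 0 (S.map h)) := by
  have := hG.tychonov
  obtain ⟨k, hk⟩ := hG.exists_isDecoding
  have := quotientSpectrum.t35Space hk
  have hcoord := quotientSpectrum.isCoordinatizedBy_proj hk
  obtain ⟨e, he⟩ := quotientSpectrum.exists_continuousMulEquiv hk
  refine ⟨_, inferInstance, quotientSpectrum hk, quotientSpectrum.isOmegaSpectrum hk,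
    quotientSpectrum.isFactorizing hk, quotientSpectrum.polishSpace hk, ⟨e, fun a => ?_⟩,
    fun a b h => ?_⟩
  · simp only [he]
    exact (hcoord a).isSoft isCoordinatizedBy_id a.2.2 .univ hk (hcoord a).continuous fun _ => rfl
  · exact (hcoord a).isSoft (hcoord b) a.2.2 b.2.2 hk
      ((quotientSpectrum hk).map h).continuous_toFun (quotientSpectrum.map_proj hk h)
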